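/- Let $p_s,p_n,p_{n_z}\in[0,\tfrac12]$. Consider the modulo-additive binary channel with input $X_i$, state $S_i$ and outputs $$Y_i=X_i\oplus S_i\oplus N_i,\qquad Z_i=X_i\oplus S_i\oplus N_{z,i},\qquad i=1,\dots,n,$$ all alphabets being $\{0,1\}$, where $S_1,\dots,S_n$ are i.i.d. $\mathrm{Bern}(p_s)$, and the noise pairs $(N_i,N_{z,i})$ are i.i.d. over $i$, independent of $(S^n,X^n)$, with marginals $N_i\sim\mathrm{Bern}(p_n)$ and $N_{z,i}\sim\mathrm{Bern}(p_{n_z})$ (the two noises may be independent, or have any other joint law with these marginals). The encoder knows the whole state sequence $S^n$ in advance and produces $X^n$ by a conditional distribution $p(x^n|s^n)$. A pair $(R_a,R_l)$ of real numbers is achievable if for every $\epsilon>0$ and all sufficiently large $n$ there is an encoder $p(x^n|s^n)$ with $$\frac1n I(S^n;Y^n)\ge R_a-\epsilon,\qquad \frac1n I(S^n;Z^n)\le R_l+\epsilon .$$ Let $\mathcal C$ be the set of achievable pairs and let $C_d=\sup_{(R_a,R_l)\in\mathcal C}(R_a-R_l)$ be the differential amplification capacity. Write $H(p)=-p\log_2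 p-(1-p)\log_2(1-p)$; mutual informations are in bits. If $p_n\le p_{n_z}$ and $H(p_s)\ge 1-H(p_n)$, then $$C_d=H(p_{n_z})-H(p_n),$$ and the supremum is attained by an achievable pair. -/

import Mathlib

namespace StateMasking

noncomputable section

/-- The Bernoulli distribution with parameter `p` on `{0, 1}`: probability `p` at `1`, probability
`1 - p` at `0`. The alphabet `{0, 1}` is `ZMod 2`, whose addition is addition modulo `2`. -/
def bern (p : unitInterval) : stdSimplex ℝ (ZMod 2) :=
  ⟨fun b => if b = 1 then (p : ℝ) else 1 - (p : ℝ), by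
    refine ⟨fun b => ?_, ?_⟩
    · dsimp only
      split_ifs
      · exact p.2.1
      · linarith [p.2.2]
    · rw [show (Finset.univ : Finset (ZMod 2)) = {0, 1} from rfl]
      simp⟩

/-- The binary entropy function `H(p) = -p log₂ p - (1 - p) log₂ (1 - p)`, in bits. -/
def binEntropy₂ (p : ℝ) : ℝ := Real.binEntropy p / Real.log 2

/-- Shannon entropy in bits, `-∑ a, p a * log₂ (p a)`, of a probability mass function `p` on a
finite set. -/
def entropy {α : Type*} [Fintype α] (p : α → ℝ) : ℝ :=
  (∑ a, Real.negMulLog (p a)) / Real.log 2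

/-- Mutual information in bits, `I(A; B) = H(A) + H(B) - H(A, B)`, of a pair of random variables
with joint probability mass function `p` on a finite set `α × β`. -/
def mutualInfo {α β : Type*} [Fintype α] [Fintype β] (p : α × β → ℝ) : ℝ :=
  entropy (fun a => ∑ b, p (a, b)) + entropy (fun b => ∑ a, p (a, b)) - entropy p

/-- A discrete memoryless state-dependent broadcast channel: the distribution `p(s)` of the i.i.d.
state, and the transition probabilities `p(y, z | x, s)`. -/
structure StateChannel (𝒳 𝒮 𝒴 𝒵 : Type*) [Fintype 𝒮] [Fintype 𝒴] [Fintype 𝒵] where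
  /-- the state distribution `p(s)` -/
  state : stdSimplex ℝ 𝒮
  /-- `trans x s` is the distribution `p(y, z | x, s)` of the output pair -/
  trans : 𝒳 → 𝒮 → stdSimplex ℝ (𝒴 × 𝒵)

/-- A (possibly randomized) encoder of blocklength `n` which knows the whole state sequence
non-causally: a conditional distribution `p(xⁿ | sⁿ)`. -/
abbrev Encoder (𝒳 𝒮 : Type*) [Fintype 𝒳] (n : ℕ) :=
  (Fin n → 𝒮) → stdSimplex ℝ (Fin n → 𝒳)

namespace StateChannel

variable {𝒳 𝒮 𝒴 𝒵 : Type*} [Fintype 𝒳] [Fintype 𝒮] [Fintype 𝒴] [Fintype 𝒵]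

/-- The joint probability of `(Sⁿ, Xⁿ, Yⁿ, Zⁿ) = (s, x, y, z)`:
`(∏ i, p(sᵢ)) * p(xⁿ | sⁿ) * ∏ i, p(yᵢ, zᵢ | xᵢ, sᵢ)`. -/
def jointLaw (W : StateChannel 𝒳 𝒮 𝒴 𝒵) {n : ℕ} (enc : Encoder 𝒳 𝒮 n)
    (s : Fin n → 𝒮) (x : Fin n → 𝒳) (y : Fin n → 𝒴) (z : Fin n → 𝒵) : ℝ :=
  (∏ i, W.state (s i)) * enc s x * ∏ i, W.trans (x i) (s i) (y i, z i)

/-- The joint law of `(Sⁿ, Yⁿ)`. -/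
def lawSY (W : StateChannel 𝒳 𝒮 𝒴 𝒵) {n : ℕ} (enc : Encoder 𝒳 𝒮 n) :
    (Fin n → 𝒮) × (Fin n → 𝒴) → ℝ :=
  fun sy => ∑ x, ∑ z, W.jointLaw enc sy.1 x sy.2 z

/-- The joint law of `(Sⁿ, Zⁿ)`. -/
def lawSZ (W : StateChannel 𝒳 𝒮 𝒴 𝒵) {n : ℕ} (enc : Encoder 𝒳 𝒮 n) :
    (Fin n → 𝒮) × (Fin n → 𝒵) → ℝ :=
  fun sz => ∑ x, ∑ y, W.jointLaw enc sz.1 x y sz.2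

/-- `(R_a, R_l)` is achievable if for every `ε > 0` and all sufficiently large `n` some encoder
of blocklength `n` satisfies `I(Sⁿ; Yⁿ) / n ≥ R_a - ε` and `I(Sⁿ; Zⁿ) / n ≤ R_l + ε`. -/
def Achievable (W : StateChannel 𝒳 𝒮 𝒴 𝒵) (Ra Rl : ℝ) : Prop :=
  ∀ ε : ℝ, 0 < ε → ∀ᶠ n : ℕ in Filter.atTop, ∃ enc : Encoder 𝒳 𝒮 n,
    Ra - ε ≤ (1 / (n : ℝ)) * mutualInfo (W.lawSY enc) ∧
    (1 / (n : ℝ)) * mutualInfo (W.lawSZ enc) ≤ Rl + ε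

/-- The trade-off region: the set of all achievable pairs `(R_a, R_l)`. -/
def region (W : StateChannel 𝒳 𝒮 𝒴 𝒵) : Set (ℝ × ℝ) := {R | W.Achievable R.1 R.2}

/-- The achievable differential amplification rates `R_a - R_l`. -/
def diffRates (W : StateChannel 𝒳 𝒮 𝒴 𝒵) : Set ℝ := (fun R : ℝ × ℝ => R.1 - R.2) '' W.region

/-- The differential amplification capacity `C_d`. -/
def diffCapacity (W : StateChannel 𝒳 𝒮 𝒴 𝒵) : ℝ := sSup W.diffRates

end StateChannel

/-- The modulo-additive binary model `Y = X ⊕ S ⊕ N`, `Z = X ⊕ S ⊕ N_z`, with state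
`S ∼ Bern(p_s)` and noise pair `(N, N_z) ∼ noise`; the noise pair is independent of `(X, S)` and
i.i.d. over time. -/
def binaryModel (ps : unitInterval) (noise : stdSimplex ℝ (ZMod 2 × ZMod 2)) :
    StateChannel (ZMod 2) (ZMod 2) (ZMod 2) (ZMod 2) where
  state := bern ps
  trans x s := stdSimplex.map (fun N => (x + s + N.1, x + s + N.2)) noise

end

end StateMasking

namespace StateMasking

open Finset

/-! Given `S = s`, each output is `T + N` with `T = X + S` independent of the noise, so only the
marginals of the noise pair matter.

Converse: for `p_n ≤ p_{n_z} ≤ 1/2` the law of `N_z` is that of `N + V` with `V` an independent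
Bernoulli variable (`exists_convolve_bern`), so `Z` may be taken as `Y + V`. Then `H(Y) ≤ H(Z)`, and
for each `s` submodularity (`natEntropy_convolve_submodular`) gives `H(T + N + V) - H(T + N) ≤ H(N +
V) - H(N)`: extra noise hides `V`. Subtracting yields `mutualInfo_sub_le`.

Achievability: the pair `(1 - H(p_n), 1 - H(p_{n_z}))` has the required difference. Its leakage
bound holds for every encoder, since `H(Zⁿ) ≤ n` and `H(Zⁿ | Sⁿ) ≥ n H(p_{n_z})`. For amplification
let `X + S = f(S)` be deterministic; then `H(Yⁿ | Sⁿ) = n H(p_n)` and `Yⁿ` must be nearly uniform. A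
random pairwise independent `f` achieves this because `H(p_s) + H(p_n) ≥ 1`
(`exists_code_natEntropy_ge`). -/

/-- Entropy in nats of a mass function on a finite set. -/
noncomputable def natEntropy {α : Type*} [Fintype α] (p : α → ℝ) : ℝ := ∑ a, Real.negMulLog (p a)

/-- Convolution of mass functions on a finite group. -/
def convolve {G : Type*} [Fintype G] [AddCommGroup G] (p q : G → ℝ) : G → ℝ :=
  fun y => ∑ v, p v * q (y - v)

/-! ### Entropy of convolutions on a finite abelian group. -/

section Group
variable {G : Type*} [Fintype G] [AddCommGroup G]

theorem sum_rotate {α β γ : Type*} [Fintype α] [Fintype β] [Fintype γ] (f : α → β → γ → ℝ) :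
    ∑ x, ∑ y, ∑ z, f x y z = ∑ z, ∑ x, ∑ y, f x y z :=
  (sum_congr rfl fun _ _ => sum_comm).trans sum_comm

theorem convolve_comm (p q : G → ℝ) : convolve p q = convolve q p := by
  funext y
  unfold convolve
  rw [← (Equiv.subLeft y).sum_comp]
  simp [mul_comm]

theorem sum_sub_right (q : G → ℝ) (v : G) : ∑ y, q (y - v) = ∑ y, q y :=
  (Equiv.subRight v).sum_comp q

theorem convolve_mem {p q : G → ℝ} (hp : p ∈ stdSimplex ℝ G) (hq : q ∈ stdSimplex ℝ G) :
    convolve p q ∈ stdSimplex ℝ G := by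
  refine ⟨fun y => sum_nonneg fun v _ => mul_nonneg (hp.1 v) (hq.1 _), ?_⟩
  unfold convolve
  rw [sum_comm]
  simp_rw [← mul_sum, sum_sub_right, hq.2, mul_one, hp.2]

theorem convolve_assoc (p q r : G → ℝ) :
    convolve (convolve p q) r = convolve p (convolve q r) := by
  funext z
  unfold convolve
  simp_rw [sum_mul, mul_sum]
  rw [sum_comm]
  refine sum_congr rfl fun x _ => ?_
  rw [← Equiv.sum_comp (Equiv.addRight x)]
  refine sum_congr rfl fun y _ => ?_
  simp [mul_assoc, sub_sub, add_comm]

theorem natEntropy_sub_right (q : G → ℝ) (v : G) :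
    natEntropy (fun y => q (y - v)) = natEntropy q :=
  (Equiv.subRight v).sum_comp fun y => Real.negMulLog (q y)

/-- Adding independent noise does not decrease the entropy. -/
theorem natEntropy_le_convolve_right {p q : G → ℝ} (hp : p ∈ stdSimplex ℝ G)
    (hq : q ∈ stdSimplex ℝ G) : natEntropy q ≤ natEntropy (convolve p q) := by
  calc natEntropy q = ∑ v, p v * natEntropy (fun y => q (y - v)) := by
        simp_rw [natEntropy_sub_right, ← sum_mul, hp.2, one_mul]
    _ = ∑ y, ∑ v, p v * Real.negMulLog (q (y - v)) := by
        simp_rw [natEntropy, mul_sum]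
        exact sum_comm
    _ ≤ natEntropy (convolve p q) := by
        refine sum_le_sum fun y _ => ?_
        have := Real.concaveOn_negMulLog.le_map_sum (t := univ) (w := p)
          (p := fun v => q (y - v)) (fun v _ => hp.1 v) hp.2 (fun v _ => hq.1 _)
        simpa [convolve, smul_eq_mul] using this

theorem natEntropy_le_convolve_left {p q : G → ℝ} (hp : p ∈ stdSimplex ℝ G)
    (hq : q ∈ stdSimplex ℝ G) : natEntropy p ≤ natEntropy (convolve p q) := by
  rw [convolve_comm]
  exact natEntropy_le_convolve_right hq hp

/-- Submodularity of entropy under convolution. -/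
theorem natEntropy_convolve_submodular {p q r : G → ℝ} (hp : p ∈ stdSimplex ℝ G)
    (hq : q ∈ stdSimplex ℝ G) (hr : r ∈ stdSimplex ℝ G) :
    natEntropy (convolve (convolve p q) r) + natEntropy q ≤
      natEntropy (convolve p q) + natEntropy (convolve q r) := by
  set a := convolve p q with ha
  set b := convolve q r with hb
  set c := convolve a r with hc
  have hcb : c = convolve p b := convolve_assoc p q r
  have ha' : a ∈ stdSimplex ℝ G := convolve_mem hp hq
  have hb' : b ∈ stdSimplex ℝ G := convolve_mem hq hr
  have hc' : c ∈ stdSimplex ℝ G := convolve_mem ha' hr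
  -- All four entropies become averages over one joint law, that of the partial sums `x`, `y`, `z`
  -- of independent variables with laws `p`, `q`, `r`.
  have e1 : natEntropy q =
      ∑ x, ∑ y, ∑ z, p x * q (y - x) * r (z - y) * -Real.log (q (y - x)) := by
    have h : ∀ x y, ∑ z, p x * q (y - x) * r (z - y) * -Real.log (q (y - x)) =
        p x * Real.negMulLog (q (y - x)) := by
      intro x y
      rw [← sum_mul, ← mul_sum, sum_sub_right, hr.2, Real.negMulLog]
      ring
    simp_rw [h, ← mul_sum]
    have h2 : ∀ x, ∑ y, Real.negMulLog (q (y - x)) = natEntropy q := natEntropy_sub_right q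
    simp_rw [h2, ← sum_mul, hp.2, one_mul]
  have e2 : natEntropy a =
      ∑ x, ∑ y, ∑ z, p x * q (y - x) * r (z - y) * -Real.log (a y) := by
    rw [sum_comm]
    refine sum_congr rfl fun y _ => ?_
    simp_rw [← sum_mul, ← mul_sum, sum_sub_right, hr.2, mul_one]
    rw [Real.negMulLog, ha, convolve]
    ring
  have e3 : natEntropy b =
      ∑ x, ∑ y, ∑ z, p x * q (y - x) * r (z - y) * -Real.log (b (z - x)) := by
    have h : ∀ x, ∑ y, ∑ z, p x * q (y - x) * r (z - y) * -Real.log (b (z - x)) =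
        p x * natEntropy b := by
      intro x
      rw [sum_comm, ← natEntropy_sub_right b x, natEntropy, mul_sum]
      refine sum_congr rfl fun z _ => ?_
      rw [← sum_mul, Real.negMulLog]
      have : ∑ y, p x * q (y - x) * r (z - y) = p x * b (z - x) := by
        rw [hb, convolve, mul_sum, ← Equiv.sum_comp (Equiv.addRight x)]
        refine sum_congr rfl fun y _ => ?_
        simp [mul_assoc, sub_sub, add_comm]
      rw [this]
      ring
    simp_rw [h, ← sum_mul, hp.2, one_mul]
  have e4 : natEntropy c =
      ∑ x, ∑ y, ∑ z, p x * q (y - x) * r (z - y) * -Real.log (c z) := by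
    rw [sum_rotate]
    refine sum_congr rfl fun z _ => ?_
    simp_rw [← sum_mul]
    have : ∑ x, ∑ y, p x * q (y - x) * r (z - y) = c z := by
      rw [sum_comm]
      simp_rw [← sum_mul]
      rfl
    rw [this, Real.negMulLog]
    ring
  -- This is `1 - 1/t ≤ log t` at `t = q c / (a b)`, weighted by the joint law. Both terms on the
  -- left have total mass 1, so their difference vanishes on summation.
  have key : ∀ x y z, p x * q (y - x) * r (z - y) -
      (a y * r (z - y)) * (p x * b (z - x)) / c z ≤
      p x * q (y - x) * r (z - y) * -Real.log (a y) +
      p x * q (y - x) * r (z - y) * -Real.log (b (z - x)) -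
      p x * q (y - x) * r (z - y) * -Real.log (c z) -
      p x * q (y - x) * r (z - y) * -Real.log (q (y - x)) := by
    intro x y z
    have hx := hp.1 x
    have hqx := hq.1 (y - x)
    have hrz := hr.1 (z - y)
    rcases (mul_nonneg (mul_nonneg hx hqx) hrz).eq_or_lt with h0 | h0
    · rw [← h0]
      have : 0 ≤ (a y * r (z - y)) * (p x * b (z - x)) / c z :=
        div_nonneg (mul_nonneg (mul_nonneg (ha'.1 _) hrz) (mul_nonneg hx (hb'.1 _))) (hc'.1 _)
      linarith
    · have hx' : 0 < p x := hx.lt_of_ne (by rintro h; simp [← h] at h0)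
      have hq' : 0 < q (y - x) := hqx.lt_of_ne (by rintro h; simp [← h] at h0)
      have hr' : 0 < r (z - y) := hrz.lt_of_ne (by rintro h; simp [← h] at h0)
      have pa : 0 < a y := lt_of_lt_of_le (mul_pos hx' hq')
        (single_le_sum (f := fun v => p v * q (y - v))
          (fun v _ => mul_nonneg (hp.1 v) (hq.1 _)) (mem_univ x))
      have pb : 0 < b (z - x) := by
        refine lt_of_lt_of_le (mul_pos hq' hr') ?_
        have := single_le_sum (f := fun v => q v * r (z - x - v))
          (fun v _ => mul_nonneg (hq.1 v) (hr.1 _)) (mem_univ (y - x))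
        simp only [sub_sub_sub_cancel_right] at this
        exact this
      have pc : 0 < c z := lt_of_lt_of_le (mul_pos pa hr')
        (single_le_sum (f := fun v => a v * r (z - v))
          (fun v _ => mul_nonneg (ha'.1 v) (hr.1 _)) (mem_univ y))
      have hl := Real.one_sub_inv_le_log_of_pos
        (x := q (y - x) * c z / (a y * b (z - x))) (by positivity)
      rw [Real.log_div (by positivity) (by positivity), Real.log_mul hq'.ne' pc.ne',
        Real.log_mul pa.ne' pb.ne'] at hl
      have := mul_le_mul_of_nonneg_left hl h0.le
      have e : p x * q (y - x) * r (z - y) * (1 - (q (y - x) * c z / (a y * b (z - x)))⁻¹) =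
          p x * q (y - x) * r (z - y) - (a y * r (z - y)) * (p x * b (z - x)) / c z := by
        field_simp
      rw [e] at this
      linarith
  have hsum := sum_le_sum fun x (_ : x ∈ univ) => sum_le_sum fun y (_ : y ∈ univ) =>
    sum_le_sum fun z (_ : z ∈ univ) => key x y z
  simp only [sum_sub_distrib, sum_add_distrib] at hsum
  rw [← e1, ← e2, ← e3, ← e4] at hsum
  have t1 : ∑ x, ∑ y, ∑ z, p x * q (y - x) * r (z - y) = 1 := by
    simp_rw [← mul_sum, sum_sub_right, hr.2, mul_one, ← mul_sum, sum_sub_right, hq.2, mul_one, hp.2]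
  have t2 : ∑ x, ∑ y, ∑ z, (a y * r (z - y)) * (p x * b (z - x)) / c z = 1 := by
    have : ∀ z, ∑ x, ∑ y, (a y * r (z - y)) * (p x * b (z - x)) / c z = c z := by
      intro z
      have h1 : ∑ y, a y * r (z - y) = c z := rfl
      have h2 : ∑ x, p x * b (z - x) = c z := by rw [hcb]; rfl
      simp_rw [← sum_div, ← sum_mul, h1, ← mul_sum, h2]
      exact mul_self_div_self _
    rw [sum_rotate, ← hc'.2]
    exact sum_congr rfl fun z _ => this z
  rw [t1, t2] at hsum
  linarith

theorem natEntropy_le_log_card {α : Type*} [Fintype α] [Nonempty α] {p : α → ℝ}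
    (hp : p ∈ stdSimplex ℝ α) : natEntropy p ≤ Real.log (Fintype.card α) := by
  have hN : (0 : ℝ) < Fintype.card α := by exact_mod_cast Fintype.card_pos
  have : ∀ a, Real.negMulLog (p a) ≤
      p a * Real.log (Fintype.card α) + ((Fintype.card α : ℝ)⁻¹ - p a) := by
    intro a
    rcases (hp.1 a).eq_or_lt with h | h
    · simp [← h]
    · have h1 := Real.log_le_sub_one_of_pos (x := (p a * Fintype.card α)⁻¹) (by positivity)
      rw [Real.log_inv, Real.log_mul h.ne' hN.ne'] at h1
      have h2 := mul_le_mul_of_nonneg_left h1 h.le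
      have h3 : p a * ((p a * Fintype.card α)⁻¹ - 1) = (Fintype.card α : ℝ)⁻¹ - p a := by
        field_simp
      rw [h3] at h2
      rw [Real.negMulLog]
      linarith
  refine (sum_le_sum fun a _ => this a).trans_eq ?_
  rw [sum_add_distrib, ← sum_mul, hp.2, sum_sub_distrib, hp.2]
  simp [hN.ne']

end Group

/-! ### Laws of independent copies. -/

section Product
variable {A : Type*} [Fintype A] {n : ℕ}

/-- The law of `n` independent copies. -/
def iidLaw (n : ℕ) (w : A → ℝ) : (Fin n → A) → ℝ := fun a => ∏ i, w (a i)

theorem sum_iidLaw_eq_pow (w : A → ℝ) : ∑ a, iidLaw n w a = (∑ b, w b) ^ n := by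
  classical
  exact (Fintype.sum_pow w n).symm

theorem iidLaw_mem {w : A → ℝ} (hw : w ∈ stdSimplex ℝ A) :
    iidLaw n w ∈ stdSimplex ℝ (Fin n → A) :=
  ⟨fun a => prod_nonneg fun i _ => hw.1 (a i), by rw [sum_iidLaw_eq_pow, hw.2, one_pow]⟩

theorem sum_iidLaw_mul_sum {w : A → ℝ} (hw : ∑ b, w b = 1) (g : A → ℝ) :
    ∑ a : Fin n → A, iidLaw n w a * ∑ j, g (a j) = n * ∑ b, w b * g b := by
  classical
  simp_rw [mul_sum]
  rw [sum_comm]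
  have : ∀ j : Fin n, ∑ a : Fin n → A, iidLaw n w a * g (a j) = ∑ b, w b * g b := by
    intro j
    -- Only the `j`-th factor carries `g`; every other factor sums to 1.
    have h := Finset.prod_univ_sum (fun _ : Fin n => (univ : Finset A))
      (fun i b => w b * if i = j then g b else 1)
    rw [Fintype.piFinset_univ] at h
    simp_rw [prod_mul_distrib, prod_ite_eq' univ j, if_pos (mem_univ j)] at h
    unfold iidLaw
    rw [← h, prod_eq_single j]
    · simp
    · intro i _ hi
      simp [hi, hw]
    · simp
  simp [this, mul_sum]

theorem natEntropy_iidLaw {w : A → ℝ} (hw : w ∈ stdSimplex ℝ A) :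
    natEntropy (iidLaw n w) = n * natEntropy w := by
  have h := sum_iidLaw_mul_sum (n := n) hw.2 fun b => -Real.log (w b)
  rw [natEntropy, natEntropy]
  have h1 : ∀ b, Real.negMulLog (w b) = w b * -Real.log (w b) := fun b => by
    rw [Real.negMulLog]; ring
  simp_rw [h1, ← h]
  refine sum_congr rfl fun a _ => ?_
  by_cases h0 : ∃ i, w (a i) = 0
  · obtain ⟨i, hi⟩ := h0
    have : iidLaw n w a = 0 := prod_eq_zero (mem_univ i) hi
    simp [this]
  · push Not at h0
    rw [Real.negMulLog, iidLaw, Real.log_prod fun i _ => h0 i, sum_neg_distrib]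
    ring

theorem convolve_iidLaw [AddCommGroup A] (w w' : A → ℝ) :
    convolve (iidLaw n w) (iidLaw n w') = iidLaw n (convolve w w') := by
  classical
  funext y
  unfold convolve iidLaw
  rw [Finset.prod_univ_sum, Fintype.piFinset_univ]
  simp [prod_mul_distrib]

end Product

/-! ### Exponential moments and random coding. -/

section Coding

/-- A Chernoff exponent: for small `t` the mean of `exp (t u)` is `1 + t E[u] + O(t²)`, and the
slack `ε` absorbs the quadratic term. -/
theorem exists_mgf_le {A : Type*} [Fintype A] {w : A → ℝ} (hw : w ∈ stdSimplex ℝ A) (u : A → ℝ)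
    (hu : ∑ b, w b * u b ≤ 0) {ε : ℝ} (hε : 0 < ε) :
    ∃ t : ℝ, 0 < t ∧ ∑ b, w b * Real.exp (t * (u b - ε)) ≤ 1 := by
  set M : ℝ := 1 + ∑ b, |u b| with hM
  have hM1 : 1 ≤ M := by
    have : 0 ≤ ∑ b, |u b| := sum_nonneg fun b _ => abs_nonneg _
    linarith
  have hb : ∀ b, |u b| ≤ M := fun b => by
    have := single_le_sum (f := fun b => |u b|) (fun b _ => abs_nonneg _) (mem_univ b)
    linarith
  have hM0 : 0 < M := by linarith
  -- `t ≤ 1 / M` keeps `|t u| ≤ 1`, where `exp v ≤ 1 + v + v²`; `t ≤ ε / M²` makes the quadratic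
  -- term at most `t ε`.
  refine ⟨min (1 / M) (ε / M ^ 2), by positivity, ?_⟩
  set t := min (1 / M) (ε / M ^ 2) with ht
  have ht0 : 0 < t := by positivity
  have ht1 : t * M ≤ 1 := by
    have := mul_le_mul_of_nonneg_right (min_le_left (1 / M) (ε / M ^ 2)) hM0.le
    rwa [one_div_mul_cancel hM0.ne'] at this
  have ht2 : t * M ^ 2 ≤ ε := by
    have := mul_le_mul_of_nonneg_right (min_le_right (1 / M) (ε / M ^ 2)) (sq_nonneg M)
    rwa [div_mul_cancel₀ _ (by positivity)] at this
  have h1 : ∀ b, Real.exp (t * u b) ≤ 1 + t * u b + t ^ 2 * M ^ 2 := by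
    intro b
    have habs : |t * u b| ≤ t * M := by
      rw [abs_mul, abs_of_pos ht0]
      exact mul_le_mul_of_nonneg_left (hb b) ht0.le
    have h := (abs_le.1 (Real.abs_exp_sub_one_sub_id_le (habs.trans ht1))).2
    have h2 : (t * u b) ^ 2 ≤ (t * M) ^ 2 := sq_le_sq' (abs_le.1 habs).1 (abs_le.1 habs).2
    nlinarith
  have h2 : ∑ b, w b * Real.exp (t * u b) ≤ Real.exp (t * ε) := by
    calc ∑ b, w b * Real.exp (t * u b) ≤ ∑ b, w b * (1 + t * u b + t ^ 2 * M ^ 2) :=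
          sum_le_sum fun b _ => mul_le_mul_of_nonneg_left (h1 b) (hw.1 b)
      _ = (1 + t ^ 2 * M ^ 2) * ∑ b, w b + t * ∑ b, w b * u b := by
          rw [mul_sum, mul_sum, ← sum_add_distrib]
          exact sum_congr rfl fun b _ => by ring
      _ ≤ t * ε + 1 := by
          rw [hw.2]
          nlinarith [mul_le_mul_of_nonneg_left hu ht0.le, mul_le_mul_of_nonneg_left ht2 ht0.le]
      _ ≤ Real.exp (t * ε) := Real.add_one_le_exp _
  simp_rw [mul_sub, Real.exp_sub, ← mul_div_assoc, ← sum_div]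
  exact (div_le_one (Real.exp_pos _)).2 h2

theorem log_one_add_exp_le (v : ℝ) {t c : ℝ} (ht : 0 < t) (hc : 0 ≤ c) :
    Real.log (1 + Real.exp v) ≤ Real.log 2 + c + Real.exp (t * (v - c)) / t := by
  have h1 : Real.log (1 + Real.exp v) ≤ Real.log 2 + max v 0 := by
    rw [← Real.log_exp (max v 0), ← Real.log_mul two_ne_zero (Real.exp_pos _).ne']
    apply Real.log_le_log (by positivity)
    have := Real.exp_le_exp.2 (le_max_left v 0)
    have := Real.one_le_exp (le_max_right v 0)
    linarith
  have h2 : v - c ≤ Real.exp (t * (v - c)) / t := by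
    rw [le_div_iff₀ ht]
    linarith [Real.add_one_le_exp (t * (v - c))]
  have h3 : 0 ≤ Real.exp (t * (v - c)) / t := by positivity
  have : max v 0 ≤ c + Real.exp (t * (v - c)) / t := max_le (by linarith) (by linarith)
  linarith

/-- `log (1 + exp v)` is within `log 2` of the positive part of `v`. For a sum with nonpositive
drift, the part exceeding `n ε` has mean at most `1 / t` by the Chernoff bound, uniformly in `n`. -/
theorem exists_sum_iidLaw_mul_log_le {A : Type*} [Fintype A] {w : A → ℝ}
    (hw : w ∈ stdSimplex ℝ A) (u : A → ℝ) (hu : ∑ b, w b * u b ≤ 0) {ε : ℝ} (hε : 0 < ε) :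
    ∃ C : ℝ, ∀ n : ℕ,
      ∑ a : Fin n → A, iidLaw n w a * Real.log (1 + Real.exp (∑ i, u (a i))) ≤ C + n * ε := by
  obtain ⟨t, ht, hmgf⟩ := exists_mgf_le hw u hu hε
  refine ⟨Real.log 2 + 1 / t, fun n => ?_⟩
  have hexp : ∑ a : Fin n → A, iidLaw n w a * Real.exp (t * (∑ i, u (a i) - n * ε)) ≤ 1 := by
    have : ∀ a : Fin n → A, iidLaw n w a * Real.exp (t * (∑ i, u (a i) - n * ε)) =
        iidLaw n (fun b => w b * Real.exp (t * (u b - ε))) a := by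
      intro a
      rw [iidLaw, iidLaw, prod_mul_distrib, ← Real.exp_sum, ← mul_sum]
      simp
    simp_rw [this, sum_iidLaw_eq_pow]
    exact pow_le_one₀ (sum_nonneg fun b _ => mul_nonneg (hw.1 b) (Real.exp_pos _).le) hmgf
  calc _ ≤ ∑ a : Fin n → A, iidLaw n w a *
        (Real.log 2 + n * ε + Real.exp (t * (∑ i, u (a i) - n * ε)) / t) :=
        sum_le_sum fun a _ => mul_le_mul_of_nonneg_left
          (log_one_add_exp_le _ ht (by positivity)) ((iidLaw_mem hw).1 a)
    _ = (Real.log 2 + n * ε) * ∑ a : Fin n → A, iidLaw n w a +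
        (∑ a : Fin n → A, iidLaw n w a * Real.exp (t * (∑ i, u (a i) - n * ε))) / t := by
        rw [mul_sum, sum_div, ← sum_add_distrib]
        exact sum_congr rfl fun a _ => by ring
    _ ≤ Real.log 2 + 1 / t + n * ε := by
        rw [(iidLaw_mem hw).2]
        have := div_le_div_of_nonneg_right hexp ht.le
        linarith

/-- Random coding with a pairwise uniform family of encoders. -/
theorem exists_natEntropy_encoded_ge {G : Type*} [Fintype G] [AddCommGroup G] {P Q : G → ℝ}
    (hP : P ∈ stdSimplex ℝ G) (hQ : Q ∈ stdSimplex ℝ G) (f : G → G → G)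
    (hf : ∀ s s', s ≠ s' → Function.Bijective fun a => f a s - f a s') :
    ∃ a, ∑ s, ∑ d, P s * Q d * -Real.log (P s * Q d + (Fintype.card G : ℝ)⁻¹) ≤
      natEntropy fun y => ∑ s, P s * Q (y - f a s) := by
  set N : ℝ := (Fintype.card G : ℝ) with hN
  have hN0 : 0 < N := by
    have : Nonempty G := ⟨0⟩
    exact Nat.cast_pos.2 Fintype.card_pos
  set R : G → G → ℝ := fun a y => ∑ s, P s * Q (y - f a s) with hR
  have hH : ∀ a, natEntropy (R a) = ∑ s, ∑ d, P s * Q d * -Real.log (R a (f a s + d)) := by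
    intro a
    have : ∀ y, Real.negMulLog (R a y) = ∑ s, P s * Q (y - f a s) * -Real.log (R a y) := by
      intro y
      rw [← sum_mul, Real.negMulLog]
      ring
    simp_rw [natEntropy, this]
    rw [sum_comm]
    refine sum_congr rfl fun s _ => ?_
    rw [← Equiv.sum_comp (Equiv.addLeft (f a s))]
    simp
  -- The term `s' = s` is `P s * Q d` for every `a`. For `s' ≠ s`, bijectivity makes the `Q`-values
  -- sum to 1 over `a`; these terms contribute at most `1 = N * N⁻¹` in all.
  have havg : ∀ s d, ∑ a, R a (f a s + d) ≤ N * (P s * Q d + N⁻¹) := by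
    intro s d
    classical
    have h1 : ∀ s', ∑ a, P s' * Q (f a s + d - f a s') ≤
        P s' + if s' = s then N * (P s * Q d) else 0 := by
      intro s'
      split_ifs with h
      · subst h
        have := hP.1 s'
        simp only [add_sub_cancel_left, sum_const, card_univ, nsmul_eq_mul]
        linarith
      · rw [← mul_sum, add_zero]
        have e : ∑ a, Q (f a s + d - f a s') = 1 := by
          have h2 := (Equiv.ofBijective _ (hf s s' (Ne.symm h))).sum_comp fun g => Q (g + d)
          have h3 := Equiv.sum_comp (Equiv.addRight d) Q
          simp only [Equiv.ofBijective_apply, sub_add_eq_add_sub] at h2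
          rw [h2, ← hQ.2, ← h3]
          rfl
        rw [e, mul_one]
    calc ∑ a, R a (f a s + d) = ∑ s', ∑ a, P s' * Q (f a s + d - f a s') := sum_comm
      _ ≤ ∑ s', (P s' + if s' = s then N * (P s * Q d) else 0) := sum_le_sum fun s' _ => h1 s'
      _ = N * (P s * Q d + N⁻¹) := by
          rw [sum_add_distrib, hP.2, sum_ite_eq' univ s, if_pos (mem_univ s), mul_add,
            mul_inv_cancel₀ hN0.ne', add_comm]
  -- Jensen's inequality for `-log`, obtained from the tangent line at `c`, which bounds the average
  -- over `a`.
  have hpt : ∀ s d, N * (P s * Q d * -Real.log (P s * Q d + N⁻¹)) ≤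
      ∑ a, P s * Q d * -Real.log (R a (f a s + d)) := by
    intro s d
    rcases (mul_nonneg (hP.1 s) (hQ.1 d)).eq_or_lt with h | h
    · simp [← h]
    set c := P s * Q d + N⁻¹ with hc
    have hc0 : 0 < c := by positivity
    have hR0 : ∀ a, 0 < R a (f a s + d) := by
      intro a
      refine h.trans_le ?_
      have := single_le_sum (f := fun s' => P s' * Q (f a s + d - f a s'))
        (fun v _ => mul_nonneg (hP.1 v) (hQ.1 _)) (mem_univ s)
      simpa using this
    have h1 : ∀ a, P s * Q d * (-Real.log c + 1 - R a (f a s + d) / c) ≤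
        P s * Q d * -Real.log (R a (f a s + d)) := by
      intro a
      have := Real.log_le_sub_one_of_pos (div_pos (hR0 a) hc0)
      rw [Real.log_div (hR0 a).ne' hc0.ne'] at this
      exact mul_le_mul_of_nonneg_left (by linarith) h.le
    refine le_trans ?_ (sum_le_sum fun a _ => h1 a)
    rw [← mul_sum, mul_left_comm]
    refine mul_le_mul_of_nonneg_left ?_ h.le
    rw [sum_sub_distrib, ← sum_div]
    have h2 : (∑ a, R a (f a s + d)) / c ≤ N := (div_le_iff₀ hc0).2 (havg s d)
    simp only [sum_const, card_univ, nsmul_eq_mul, ← hN]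
    linarith
  obtain ⟨a, -, ha⟩ := exists_le_of_sum_le (s := (univ : Finset G))
    (f := fun _ => ∑ s, ∑ d, P s * Q d * -Real.log (P s * Q d + N⁻¹))
    (g := fun a => natEntropy (R a)) ⟨0, mem_univ _⟩ (by
      simp_rw [hH]
      rw [sum_const, card_univ, nsmul_eq_mul, ← hN, ← sum_rotate, mul_sum]
      simp_rw [mul_sum]
      exact sum_le_sum fun s _ => sum_le_sum fun d _ => hpt s d)
  exact ⟨a, ha⟩

/-- Multiplication `s ↦ a s` in the field with `2 ^ n` elements: `a ↦ a (s - s')` is bijective when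
`s ≠ s'`. -/
theorem exists_pairwise_bijective_family {n : ℕ} (hn : n ≠ 0) :
    ∃ f : (Fin n → ZMod 2) → (Fin n → ZMod 2) → (Fin n → ZMod 2),
      ∀ s s', s ≠ s' → Function.Bijective fun a => f a s - f a s' := by
  have : Fact (Nat.Prime 2) := ⟨Nat.prime_two⟩
  let e : GaloisField 2 n ≃ₗ[ZMod 2] (Fin n → ZMod 2) :=
    LinearEquiv.ofFinrankEq _ _ (by rw [GaloisField.finrank 2 hn]; simp)
  refine ⟨fun a s => e (e.symm a * e.symm s), fun s s' h => ?_⟩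
  refine (Finite.injective_iff_bijective).1 fun a b hab => ?_
  simp only [← map_sub e, ← mul_sub] at hab
  have h0 : e.symm s - e.symm s' ≠ 0 := sub_ne_zero.2 fun h' => h (e.symm.injective h')
  exact e.symm.injective (mul_right_cancel₀ h0 (e.injective hab))

/-- The random coding bound falls short of `n log 2` by the mean of `log (1 + 2ⁿ w)`, where `w` is
the joint probability of state and noise. Per letter, `log (2 w)` has mean `log 2 - H(p) - H(q) ≤
0`, so the loss is at most `C + n ε`. -/
theorem exists_code_natEntropy_ge {p q : ZMod 2 → ℝ} (hp : p ∈ stdSimplex ℝ (ZMod 2))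
    (hq : q ∈ stdSimplex ℝ (ZMod 2)) (h : Real.log 2 ≤ natEntropy p + natEntropy q)
    {ε : ℝ} (hε : 0 < ε) :
    ∃ C : ℝ, ∀ n : ℕ, n ≠ 0 → ∃ f : (Fin n → ZMod 2) → (Fin n → ZMod 2),
      n * Real.log 2 - (C + n * ε) ≤
        natEntropy fun y => ∑ s, iidLaw n p s * iidLaw n q (y - f s) := by
  set w : ZMod 2 × ZMod 2 → ℝ := fun b => p b.1 * q b.2 with hw
  set u : ZMod 2 × ZMod 2 → ℝ := fun b => Real.log (2 * w b) with hu
  have hw' : w ∈ stdSimplex ℝ (ZMod 2 × ZMod 2) := by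
    refine ⟨fun b => mul_nonneg (hp.1 _) (hq.1 _), ?_⟩
    rw [Fintype.sum_prod_type]
    simp_rw [hw, ← mul_sum, hq.2, mul_one, hp.2]
  have hmean : ∑ b, w b * u b ≤ 0 := by
    have h1 : ∀ b, w b * u b = w b * Real.log 2 - q b.2 * Real.negMulLog (p b.1)
        - p b.1 * Real.negMulLog (q b.2) := by
      intro b
      by_cases hb : w b = 0
      · have := Real.negMulLog_mul (p b.1) (q b.2)
        rw [show p b.1 * q b.2 = w b from rfl, hb, Real.negMulLog_zero] at this
        rw [hb]
        linarith
      · have hp0 : p b.1 ≠ 0 := left_ne_zero_of_mul hb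
        have hq0 : q b.2 ≠ 0 := right_ne_zero_of_mul hb
        simp only [hu, hw, Real.negMulLog]
        rw [Real.log_mul two_ne_zero (mul_ne_zero hp0 hq0), Real.log_mul hp0 hq0]
        ring
    have h2 : ∑ b : ZMod 2 × ZMod 2, q b.2 * Real.negMulLog (p b.1) = natEntropy p := by
      rw [Fintype.sum_prod_type]
      simp_rw [← sum_mul, hq.2, one_mul]
      rfl
    have h3 : ∑ b : ZMod 2 × ZMod 2, p b.1 * Real.negMulLog (q b.2) = natEntropy q := by
      rw [Fintype.sum_prod_type]
      simp_rw [← mul_sum, ← sum_mul, hp.2, one_mul]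
      rfl
    simp_rw [h1, sum_sub_distrib, h2, h3, ← sum_mul, hw'.2]
    linarith
  obtain ⟨C, hC⟩ := exists_sum_iidLaw_mul_log_le hw' u hmean hε
  refine ⟨C, fun n hn => ?_⟩
  obtain ⟨f, hf⟩ := exists_pairwise_bijective_family hn
  obtain ⟨a, ha⟩ := exists_natEntropy_encoded_ge (iidLaw_mem (n := n) hp) (iidLaw_mem hq) f hf
  refine ⟨f a, le_trans ?_ ha⟩
  have hcard : (Fintype.card (Fin n → ZMod 2) : ℝ) = 2 ^ n := by simp
  -- Where some letter has mass 0, `u` takes the default `log 0 = 0` there and the exponential is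
  -- not `2ⁿ w`; the weight `iidLaw n w c` then vanishes.
  have key : ∀ c : Fin n → ZMod 2 × ZMod 2,
      iidLaw n w c * Real.log 2 * n - iidLaw n w c * Real.log (1 + Real.exp (∑ i, u (c i))) =
      iidLaw n w c * -Real.log (iidLaw n w c + ((2 : ℝ) ^ n)⁻¹) := by
    intro c
    rcases ((iidLaw_mem hw').1 c).eq_or_lt with h0 | h0
    · simp [← h0]
    have hpos : ∀ i, 0 < w (c i) := fun i => (hw'.1 _).lt_of_ne fun h' =>
      h0.ne' (prod_eq_zero (mem_univ i) h'.symm)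
    have e1 : Real.exp (∑ i, u (c i)) = 2 ^ n * iidLaw n w c := by
      rw [Real.exp_sum, iidLaw]
      simp_rw [hu, Real.exp_log (mul_pos two_pos (hpos _)), prod_mul_distrib]
      simp
    have e2 : 1 + Real.exp (∑ i, u (c i)) = 2 ^ n * (iidLaw n w c + ((2 : ℝ) ^ n)⁻¹) := by
      rw [e1]
      field_simp
      ring
    rw [e2, Real.log_mul (by positivity) (by positivity), Real.log_pow]
    ring
  have hsum : ∑ s, ∑ d, iidLaw n p s * iidLaw n q d * -Real.log (iidLaw n p s * iidLaw n q d +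
      (Fintype.card (Fin n → ZMod 2) : ℝ)⁻¹) =
      ∑ c, iidLaw n w c * -Real.log (iidLaw n w c + ((2 : ℝ) ^ n)⁻¹) := by
    rw [hcard, ← Fintype.sum_prod_type', ← (Equiv.arrowProdEquivProdArrow _ _ _).sum_comp]
    refine sum_congr rfl fun c _ => ?_
    have : iidLaw n w c = iidLaw n p (fun i => (c i).1) * iidLaw n q (fun i => (c i).2) :=
      prod_mul_distrib
    rw [this]
    rfl
  rw [hsum, ← sum_congr rfl fun c _ => key c, sum_sub_distrib, ← sum_mul, ← sum_mul,
    (iidLaw_mem hw').2]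
  linarith [hC n]

end Coding

/-! ### Output laws as additive kernels, and their mutual informations. -/

section Law

theorem sum_snd_eq_map_fst {X Y : Type*} [Fintype X] [Fintype Y] (p : stdSimplex ℝ (X × Y))
    (x : X) : ∑ b, p (x, b) = stdSimplex.map Prod.fst p x := by
  classical
  rw [stdSimplex.map_coe, FunOnFinite.linearMap_apply_apply, sum_filter, Fintype.sum_prod_type,
    sum_comm]
  simp

theorem sum_fst_eq_map_snd {X Y : Type*} [Fintype X] [Fintype Y] (p : stdSimplex ℝ (X × Y))
    (y : Y) : ∑ a, p (a, y) = stdSimplex.map Prod.snd p y := by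
  classical
  rw [stdSimplex.map_coe, FunOnFinite.linearMap_apply_apply, sum_filter, Fintype.sum_prod_type]
  simp

theorem map_add_left_apply {G : Type*} [Fintype G] [AddCommGroup G] (p : stdSimplex ℝ G)
    (c y : G) : stdSimplex.map (fun d => c + d) p y = p (y - c) := by
  classical
  rw [stdSimplex.map_coe, FunOnFinite.linearMap_apply_apply, sum_filter]
  simp_rw [← eq_sub_iff_add_eq']
  simp

theorem sum_prod_pair {A : Type*} [Fintype A] {n : ℕ} (g : Fin n → A → ℝ) :
    ∑ z : Fin n → A, ∏ i, g i (z i) = ∏ i, ∑ b, g i b := by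
  classical
  rw [Finset.prod_univ_sum, Fintype.piFinset_univ]

variable (ps : unitInterval) (noise : stdSimplex ℝ (ZMod 2 × ZMod 2)) {n : ℕ}

/-- The law of the noiseless output `X + S` given the state sequence. -/
def inputLaw (enc : Encoder (ZMod 2) (ZMod 2) n) (s : Fin n → ZMod 2) : (Fin n → ZMod 2) → ℝ :=
  fun v => enc s (v - s)

theorem inputLaw_mem (enc : Encoder (ZMod 2) (ZMod 2) n) (s : Fin n → ZMod 2) :
    inputLaw enc s ∈ stdSimplex ℝ (Fin n → ZMod 2) :=
  ⟨fun _ => stdSimplex.zero_le _ _, by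
    unfold inputLaw
    rw [sum_sub_right (fun v => enc s v) s]
    exact stdSimplex.sum_eq_one _⟩

theorem sum_trans_fst (x s y : ZMod 2) :
    ∑ b, (binaryModel ps noise).trans x s (y, b) =
      stdSimplex.map Prod.fst noise (y - (x + s)) := by
  rw [sum_snd_eq_map_fst, ← map_add_left_apply, binaryModel, stdSimplex.map_comp_apply,
    stdSimplex.map_comp_apply]
  rfl

theorem sum_trans_snd (x s z : ZMod 2) :
    ∑ a, (binaryModel ps noise).trans x s (a, z) =
      stdSimplex.map Prod.snd noise (z - (x + s)) := by
  rw [sum_fst_eq_map_snd, ← map_add_left_apply, binaryModel, stdSimplex.map_comp_apply,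
    stdSimplex.map_comp_apply]
  rfl

theorem sum_encoder_eq_convolve (enc : Encoder (ZMod 2) (ZMod 2) n) (w : ZMod 2 → ℝ)
    (s y : Fin n → ZMod 2) :
    ∑ x, enc s x * ∏ i, w (y i - (x i + s i)) = convolve (inputLaw enc s) (iidLaw n w) y := by
  unfold convolve inputLaw
  refine (Equiv.sum_comp (Equiv.subRight s) _).symm.trans ?_
  simp [iidLaw]

theorem lawSY_eq (enc : Encoder (ZMod 2) (ZMod 2) n) :
    (binaryModel ps noise).lawSY enc = fun sy => iidLaw n (bern ps) sy.1 *
      convolve (inputLaw enc sy.1) (iidLaw n (stdSimplex.map Prod.fst noise)) sy.2 := by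
  funext ⟨s, y⟩
  rw [← sum_encoder_eq_convolve, mul_sum]
  refine sum_congr rfl fun x _ => ?_
  simp only [StateChannel.jointLaw, ← mul_sum]
  rw [sum_prod_pair fun i b => (binaryModel ps noise).trans (x i) (s i) (y i, b), mul_assoc]
  simp_rw [sum_trans_fst]
  rfl

theorem lawSZ_eq (enc : Encoder (ZMod 2) (ZMod 2) n) :
    (binaryModel ps noise).lawSZ enc = fun sz => iidLaw n (bern ps) sz.1 *
      convolve (inputLaw enc sz.1) (iidLaw n (stdSimplex.map Prod.snd noise)) sz.2 := by
  funext ⟨s, z⟩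
  rw [← sum_encoder_eq_convolve, mul_sum]
  refine sum_congr rfl fun x _ => ?_
  simp only [StateChannel.jointLaw, ← mul_sum]
  rw [sum_prod_pair fun i a => (binaryModel ps noise).trans (x i) (s i) (a, z i), mul_assoc]
  simp_rw [sum_trans_snd]
  rfl

/-- The chain rule `H(S, Y) = H(S) + H(Y | S)`, from the product rule for `negMulLog`. -/
theorem mutualInfo_mul_kernel {α β : Type*} [Fintype α] [Fintype β] {P : α → ℝ} {K : α → β → ℝ}
    (hK : ∀ s, K s ∈ stdSimplex ℝ β) :
    mutualInfo (fun sy : α × β => P sy.1 * K sy.1 sy.2) =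
      (natEntropy (fun y => ∑ s, P s * K s y) - ∑ s, P s * natEntropy (K s)) / Real.log 2 := by
  have h1 : ∀ s, ∑ b, P s * K s b = P s := fun s => by rw [← mul_sum, (hK s).2, mul_one]
  have h2 : ∑ a : α × β, Real.negMulLog (P a.1 * K a.1 a.2) =
      natEntropy P + ∑ s, P s * natEntropy (K s) := by
    rw [Fintype.sum_prod_type, natEntropy, ← sum_add_distrib]
    refine sum_congr rfl fun s _ => ?_
    simp_rw [Real.negMulLog_mul, sum_add_distrib, ← sum_mul, ← mul_sum, (hK s).2, one_mul]
    rfl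
  simp only [mutualInfo, entropy, h1, h2, natEntropy]
  ring

theorem sum_mul_convolve {G : Type*} [Fintype G] [AddCommGroup G] (P : G → ℝ) (T : G → G → ℝ)
    (W : G → ℝ) : (fun y => ∑ s, P s * convolve (T s) W y) =
      convolve (fun v => ∑ s, P s * T s v) W := by
  funext y
  unfold convolve
  simp_rw [mul_sum, sum_mul]
  rw [sum_comm]
  simp_rw [mul_assoc]

theorem mixture_mem {α β : Type*} [Fintype α] [Fintype β] {P : α → ℝ} {T : α → β → ℝ}
    (hP : P ∈ stdSimplex ℝ α) (hT : ∀ s, T s ∈ stdSimplex ℝ β) :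
    (fun v => ∑ s, P s * T s v) ∈ stdSimplex ℝ β := by
  refine ⟨fun v => sum_nonneg fun s _ => mul_nonneg (hP.1 s) ((hT s).1 v), ?_⟩
  rw [sum_comm]
  simp_rw [← mul_sum, (hT _).2, mul_one, hP.2]

theorem mutualInfo_additive {G : Type*} [Fintype G] [AddCommGroup G] {P W : G → ℝ}
    {T : G → G → ℝ} (hT : ∀ s, T s ∈ stdSimplex ℝ G)
    (hW : W ∈ stdSimplex ℝ G) :
    mutualInfo (fun sy : G × G => P sy.1 * convolve (T sy.1) W sy.2) =
      (natEntropy (convolve (fun v => ∑ s, P s * T s v) W) -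
        ∑ s, P s * natEntropy (convolve (T s) W)) / Real.log 2 := by
  rw [mutualInfo_mul_kernel fun s => convolve_mem (hT s) hW, sum_mul_convolve]

/-- For a degraded additive channel, `I(S; Y) - I(S; Z) ≤ H(N_z) - H(N)`. -/
theorem mutualInfo_sub_le {G : Type*} [Fintype G] [AddCommGroup G] {P W V : G → ℝ}
    {T : G → G → ℝ} (hP : P ∈ stdSimplex ℝ G) (hT : ∀ s, T s ∈ stdSimplex ℝ G)
    (hW : W ∈ stdSimplex ℝ G) (hV : V ∈ stdSimplex ℝ G) :
    mutualInfo (fun sy : G × G => P sy.1 * convolve (T sy.1) W sy.2) -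
      mutualInfo (fun sz : G × G => P sz.1 * convolve (T sz.1) (convolve W V) sz.2) ≤
      (natEntropy (convolve W V) - natEntropy W) / Real.log 2 := by
  rw [mutualInfo_additive hT hW, mutualInfo_additive hT (convolve_mem hW hV), ← sub_div]
  refine div_le_div_of_nonneg_right ?_ (Real.log_nonneg one_le_two)
  have hm := mixture_mem hP hT
  have h1 := natEntropy_le_convolve_left (convolve_mem hm hW) hV
  rw [convolve_assoc] at h1
  have h2 : ∑ s, P s * natEntropy (convolve (T s) (convolve W V)) ≤
      ∑ s, P s * natEntropy (convolve (T s) W) + (natEntropy (convolve W V) - natEntropy W) := by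
    calc _ ≤ ∑ s, P s * (natEntropy (convolve (T s) W) +
          (natEntropy (convolve W V) - natEntropy W)) := by
          refine sum_le_sum fun s _ => mul_le_mul_of_nonneg_left ?_ (hP.1 s)
          have := natEntropy_convolve_submodular (hT s) hW hV
          rw [convolve_assoc] at this
          linarith
      _ = _ := by simp_rw [mul_add, sum_add_distrib, ← sum_mul, hP.2, one_mul]
  linarith

theorem mutualInfo_additive_le {G : Type*} [Fintype G] [AddCommGroup G] {P W : G → ℝ}
    {T : G → G → ℝ} (hP : P ∈ stdSimplex ℝ G) (hT : ∀ s, T s ∈ stdSimplex ℝ G)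
    (hW : W ∈ stdSimplex ℝ G) :
    mutualInfo (fun sy : G × G => P sy.1 * convolve (T sy.1) W sy.2) ≤
      (Real.log (Fintype.card G) - natEntropy W) / Real.log 2 := by
  rw [mutualInfo_additive hT hW]
  refine div_le_div_of_nonneg_right ?_ (Real.log_nonneg one_le_two)
  have : Nonempty G := ⟨0⟩
  have h1 := natEntropy_le_log_card (convolve_mem (mixture_mem hP hT) hW)
  have h2 : natEntropy W ≤ ∑ s, P s * natEntropy (convolve (T s) W) := by
    calc natEntropy W = ∑ s, P s * natEntropy W := by rw [← sum_mul, hP.2, one_mul]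
      _ ≤ _ := sum_le_sum fun s _ => mul_le_mul_of_nonneg_left
          (natEntropy_le_convolve_right (hT s) hW) (hP.1 s)
  linarith

end Law

/-! ### Bernoulli laws. -/

section Binary

theorem bern_mem (p : unitInterval) : ⇑(bern p) ∈ stdSimplex ℝ (ZMod 2) := (bern p).2

theorem bern_zero (p : unitInterval) : bern p 0 = 1 - (p : ℝ) := by
  change (if (0 : ZMod 2) = 1 then (p : ℝ) else 1 - p) = _
  simp

theorem bern_one (p : unitInterval) : bern p 1 = (p : ℝ) := by
  change (if (1 : ZMod 2) = 1 then (p : ℝ) else 1 - p) = _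
  simp

theorem natEntropy_bern (p : unitInterval) : natEntropy (bern p) = Real.binEntropy p := by
  rw [natEntropy, Real.binEntropy_eq_negMulLog_add_negMulLog_one_sub,
    show (univ : Finset (ZMod 2)) = {0, 1} from rfl, sum_pair zero_ne_one, bern_zero, bern_one,
    add_comm]

theorem natEntropy_iidLaw_bern (n : ℕ) (p : unitInterval) :
    natEntropy (iidLaw n (bern p)) = n * (binEntropy₂ p * Real.log 2) := by
  rw [natEntropy_iidLaw (bern_mem p), natEntropy_bern, binEntropy₂,
    div_mul_cancel₀ _ (Real.log_pos one_lt_two).ne']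

theorem exists_convolve_bern {p r : unitInterval} (hr : (r : ℝ) ≤ 1 / 2) (h : (p : ℝ) ≤ r) :
    ∃ q : unitInterval, convolve (bern p) (bern q) = (bern r : ZMod 2 → ℝ) := by
  obtain ⟨q, hq⟩ : ∃ q : unitInterval, (p : ℝ) * (1 - q) + (1 - p) * q = r := by
    rcases eq_or_ne (p : ℝ) (1 / 2) with hp | hp
    -- Here `r = 1/2` as well, so no extra noise is needed.
    · exact ⟨0, by simp; linarith⟩
    · have hp' : 0 < 1 - 2 * (p : ℝ) := by
        have : (p : ℝ) < 1 / 2 := lt_of_le_of_ne (h.trans hr) hp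
        linarith
      refine ⟨⟨(r - p) / (1 - 2 * p), div_nonneg (by linarith) hp'.le,
        (div_le_one hp').2 (by linarith [p.2.1])⟩, ?_⟩
      have := div_mul_cancel₀ ((r : ℝ) - p) hp'.ne'
      simp only
      linarith
  refine ⟨q, ?_⟩
  funext y
  rw [convolve, show (univ : Finset (ZMod 2)) = {0, 1} from rfl, sum_pair zero_ne_one]
  obtain rfl | rfl : y = 0 ∨ y = 1 := by revert y; decide
  · rw [show (0 : ZMod 2) - 0 = 0 from rfl, show (0 : ZMod 2) - 1 = 1 from rfl]
    simp only [bern_zero, bern_one]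
    linarith
  · rw [show (1 : ZMod 2) - 0 = 1 from rfl, show (1 : ZMod 2) - 1 = 0 from rfl]
    simp only [bern_zero, bern_one]
    linarith

end Binary

/-! ### Converse and achievability. -/

section Capacity

variable {ps pn pnz : unitInterval} {noise : stdSimplex ℝ (ZMod 2 × ZMod 2)}

theorem diffRates_le (hpnz : (pnz : ℝ) ≤ 1 / 2)
    (hN : stdSimplex.map Prod.fst noise = bern pn) (hNz : stdSimplex.map Prod.snd noise = bern pnz)
    (hdeg : (pn : ℝ) ≤ pnz) {d : ℝ} (hd : d ∈ (binaryModel ps noise).diffRates) :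
    d ≤ binEntropy₂ pnz - binEntropy₂ pn := by
  obtain ⟨⟨Ra, Rl⟩, hR, rfl⟩ := hd
  obtain ⟨q, hq⟩ := exists_convolve_bern hpnz hdeg
  refine le_of_forall_pos_le_add fun ε hε => ?_
  -- The bound on the difference is not asymptotic, so one positive blocklength suffices.
  obtain ⟨n, ⟨enc, ha, hl⟩, hn⟩ :=
    ((hR (ε / 2) (half_pos hε)).and (Filter.eventually_gt_atTop 0)).exists
  have hn' : (0 : ℝ) < n := by exact_mod_cast hn
  have h := mutualInfo_sub_le (iidLaw_mem (n := n) (bern_mem ps)) (inputLaw_mem enc)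
    (iidLaw_mem (n := n) (bern_mem pn)) (iidLaw_mem (bern_mem q))
  have e : convolve (iidLaw n (bern pn)) (iidLaw n (bern q)) = iidLaw n (bern pnz) := by
    rw [convolve_iidLaw]
    exact congrArg _ hq
  rw [e] at h
  have hlog := Real.log_pos one_lt_two
  rw [natEntropy_iidLaw_bern, natEntropy_iidLaw_bern, ← mul_sub, ← sub_mul, ← mul_assoc,
    mul_div_cancel_right₀ _ hlog.ne'] at h
  rw [lawSY_eq, hN] at ha
  rw [lawSZ_eq, hNz] at hl
  have h' := mul_le_mul_of_nonneg_left h (one_div_pos.2 hn').le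
  rw [← mul_assoc, one_div_mul_cancel hn'.ne', one_mul, mul_sub] at h'
  have hsub := (sub_le_sub ha hl).trans h'
  simp only at hsub ⊢
  linarith

theorem achievable_capacity_pair (hN : stdSimplex.map Prod.fst noise = bern pn)
    (hNz : stdSimplex.map Prod.snd noise = bern pnz)
    (hH : 1 - binEntropy₂ pn ≤ binEntropy₂ ps) :
    (binaryModel ps noise).Achievable (1 - binEntropy₂ pn) (1 - binEntropy₂ pnz) := by
  intro ε hε
  have hlog := Real.log_pos one_lt_two
  have hent : Real.log 2 ≤ natEntropy (bern ps) + natEntropy (bern pn) := by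
    rw [natEntropy_bern, natEntropy_bern]
    rw [binEntropy₂, binEntropy₂, sub_le_iff_le_add, ← add_div, le_div_iff₀ hlog, one_mul] at hH
    exact hH
  -- `ε * Real.log 2` is the slack per letter in nats: half is spent here, and half absorbs `C` for
  -- large `n`.
  obtain ⟨C, hC⟩ := exists_code_natEntropy_ge (bern_mem ps) (bern_mem pn) hent
    (ε := ε * Real.log 2 / 2) (by positivity)
  have hlarge : ∀ᶠ n : ℕ in Filter.atTop, C / (ε * Real.log 2 / 2) ≤ n :=
    tendsto_natCast_atTop_atTop.eventually_ge_atTop _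
  filter_upwards [hlarge, Filter.eventually_gt_atTop 0] with n hn hn0
  have hn' : (0 : ℝ) < n := by exact_mod_cast hn0
  rw [div_le_iff₀ (by positivity)] at hn
  obtain ⟨f, hf⟩ := hC n hn0.ne'
  -- The deterministic input `f s - s` cancels the state, so that `X + S = f s`.
  let enc : Encoder (ZMod 2) (ZMod 2) n := fun s => stdSimplex.vertex (f s - s)
  have hin : ∀ s, inputLaw enc s = Pi.single (f s) 1 := by
    intro s
    funext v
    change (Pi.single (f s - s) 1 : (Fin n → ZMod 2) → ℝ) (v - s) = _
    simp [Pi.single_apply]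
  have hconv : ∀ s, convolve (inputLaw enc s) (iidLaw n (bern pn)) =
      fun y => iidLaw n (bern pn) (y - f s) := by
    intro s
    funext y
    rw [hin, convolve]
    simp [Pi.single_apply]
  refine ⟨enc, ?_, ?_⟩
  · rw [lawSY_eq, hN, mutualInfo_mul_kernel (K := fun s => convolve (inputLaw enc s) _)
      fun s => convolve_mem (inputLaw_mem enc s) (iidLaw_mem (bern_mem pn))]
    simp_rw [hconv, natEntropy_sub_right, ← sum_mul]
    have hone : ∑ s, iidLaw n (bern ps) s = 1 := (iidLaw_mem (bern_mem ps)).2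
    rw [hone, one_mul, natEntropy_iidLaw_bern, one_div, ← div_eq_inv_mul, le_div_iff₀ hn',
      le_div_iff₀ hlog]
    linarith
  · have h := mutualInfo_additive_le (iidLaw_mem (n := n) (bern_mem ps)) (inputLaw_mem enc)
      (iidLaw_mem (n := n) (bern_mem pnz))
    rw [natEntropy_iidLaw_bern, Fintype.card_fun, ZMod.card, Fintype.card_fin, Nat.cast_pow, Real.log_pow,
      Nat.cast_ofNat, ← mul_sub, le_div_iff₀ hlog] at h
    rw [lawSZ_eq, hNz, one_div, ← div_eq_inv_mul, div_le_iff₀ hn']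
    have h' : _ ≤ (n * (1 - binEntropy₂ pnz)) * Real.log 2 := h.trans_eq (by ring)
    have h2 := le_of_mul_le_mul_right h' hlog
    refine le_trans h2 ?_
    nlinarith [mul_pos hε hn']

end Capacity

end StateMasking

theorem mainTheorem8 (ps pn pnz : unitInterval)
    (hps : (ps : ℝ) ≤ 1 / 2) (hpn : (pn : ℝ) ≤ 1 / 2) (hpnz : (pnz : ℝ) ≤ 1 / 2)
    (noise : stdSimplex ℝ (ZMod 2 × ZMod 2))
    (hN : stdSimplex.map Prod.fst noise = StateMasking.bern pn)
    (hNz : stdSimplex.map Prod.snd noise = StateMasking.bern pnz)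
    (hdeg : (pn : ℝ) ≤ (pnz : ℝ))
    (hH : 1 - StateMasking.binEntropy₂ pn ≤ StateMasking.binEntropy₂ ps) :
    IsGreatest (StateMasking.binaryModel ps noise).diffRates
        (StateMasking.binEntropy₂ pnz - StateMasking.binEntropy₂ pn) ∧
      (StateMasking.binaryModel ps noise).diffCapacity =
        StateMasking.binEntropy₂ pnz - StateMasking.binEntropy₂ pn := by
  have h : IsGreatest (StateMasking.binaryModel ps noise).diffRates
      (StateMasking.binEntropy₂ pnz - StateMasking.binEntropy₂ pn) :=
    ⟨⟨(1 - StateMasking.binEntropy₂ pn, 1 - StateMasking.binEntropy₂ pnz),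
      StateMasking.achievable_capacity_pair hN hNz hH, sub_sub_sub_cancel_left _ _ _⟩,
      fun _ hd => StateMasking.diffRates_le hpnz hN hNz hdeg hd⟩
  exact ⟨h, h.csSup_eq⟩
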